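/- Let $(H,W,\mu)$ be an abstract Wiener space: $H$ is a real separable Hilbert space, embedded continuously and densely into a real separable Banach space $W$ by an injective continuous linear map $i:H\to W$ with dense range, and $\mu$ is the Borel probability measure on $W$ with $$\int_W e^{\sqrt{-1}\,\varphi(x)}\,d\mu(x)=\exp\Bigl(-\tfrac12\|\varphi\circ i\|_{H^*}^2\Bigr)\qquad\text{for all }\varphi\in W^*.$$ Identify $W^*$ with a subspace of $H$ by identifying $\varphi\in W^*$ with the vector of $H$ that represents $\varphi\circ i\in H^*$. A *rotation* is an orthogonal transformation $R$ of $H$ that restricts to a homeomorphism of $W^*$ (with its norm topology) onto itself; its adjoint $R^*:W\to W$ is defined by $\varphi(R^*w)=(R^{-1}\varphi)(w)$ for all $\varphi\in W^*$, $w\in W$. For $h\in H$ let $T_h w=w+i(h)$. 1. (Translations.) For every $h\in H$ the measures $(T_h)_*\mu$ and $\mu$ are mutually absolutely continuous. The Radon–Nikodym derivative $J_h=d(T_h)_*\mu/d\mu$ satisfies, for every real $p\in[1,\infty)$, $$\|J_h\|_{L^p(W,\mu)}\le\exp\Bigl(\frac{(p-1)\|h\|_H^2}{2}\Bigr),$$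 and this bound is sharp: equality holds for all $h\in H$ and $p\in[1,\infty)$. 2. (Rotations.) For every rotation $R$ there is exactly one map $R^*:W\to W$ with the defining property above, it is Borel measurable, and $(R^*)_*\mu=\mu$. -/

import Mathlib

open MeasureTheory ProbabilityTheory

/-- `(H, W, μ)` is an abstract Wiener space with inclusion map `i : H → W`: the Hilbert space `H`
is continuously and densely embedded into the Banach space `W` by `i`, and `μ` is the Gaussian
measure on `W` with characteristic functional
`∫ exp (i φ(x)) dμ(x) = exp (- |φ|_{H*} ^ 2 / 2)` for `φ ∈ W*`, where `|φ|_{H*}` is the norm in `H*`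
of the restriction `φ ∘ i` of `φ` to `H`. -/
structure IsAbstractWienerSpace {H W : Type*}
    [NormedAddCommGroup H] [InnerProductSpace ℝ H]
    [NormedAddCommGroup W] [NormedSpace ℝ W] [MeasurableSpace W]
    (i : H →L[ℝ] W) (μ : Measure W) : Prop where
  injective : Function.Injective i
  denseRange : DenseRange i
  isProbabilityMeasure : IsProbabilityMeasure μ
  charFunctional : ∀ φ : StrongDual ℝ W,
    ∫ x, Complex.exp ((φ x : ℂ) * Complex.I) ∂μ = Complex.exp (-((‖φ.comp i‖ : ℂ) ^ 2) / 2)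

/-- The identification of `W*` with a subspace of `H`: the functional `φ ∈ W*` is identified with
the vector of `H` that represents its restriction `φ ∘ i ∈ H*` in the sense of Riesz. -/
noncomputable def dualToH {H W : Type*}
    [NormedAddCommGroup H] [InnerProductSpace ℝ H] [CompleteSpace H]
    [NormedAddCommGroup W] [NormedSpace ℝ W]
    (i : H →L[ℝ] W) (φ : StrongDual ℝ W) : H :=
  (InnerProductSpace.toDual ℝ H).symm (φ.comp i)

/-- The defining property of the identification of `W*` with a subspace of `H`. -/
theorem inner_dualToH {H W : Type*}
    [NormedAddCommGroup H] [InnerProductSpace ℝ H] [CompleteSpace H]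
    [NormedAddCommGroup W] [NormedSpace ℝ W]
    (i : H →L[ℝ] W) (φ : StrongDual ℝ W) (h : H) :
    inner ℝ (dualToH i φ) h = φ (i h) := by
  simp [dualToH]

/-- The rotations: orthogonal transformations of `H` that restrict to a homeomorphism of
`W* ⊆ H`, where `W*` carries its norm topology. When `i` has dense range, `W* → H` is injective and
`dualHomeo` is determined by `toH`. -/
structure WienerRotation {H W : Type*}
    [NormedAddCommGroup H] [InnerProductSpace ℝ H] [CompleteSpace H]
    [NormedAddCommGroup W] [NormedSpace ℝ W]
    (i : H →L[ℝ] W) where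
  /-- the orthogonal transformation of `H` -/
  toH : H ≃ₗᵢ[ℝ] H
  /-- its restriction to `W*` -/
  dualHomeo : StrongDual ℝ W ≃ₜ StrongDual ℝ W
  dualToH_dualHomeo : ∀ φ : StrongDual ℝ W, dualToH i (dualHomeo φ) = toH (dualToH i φ)

/-- `T : W → W` is the adjoint `R*` of the rotation `R`: `⟨φ, T w⟩ = ⟨R⁻¹ φ, w⟩` for all
`φ ∈ W*` and `w ∈ W`. -/
def WienerRotation.IsAdjoint {H W : Type*}
    [NormedAddCommGroup H] [InnerProductSpace ℝ H] [CompleteSpace H]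
    [NormedAddCommGroup W] [NormedSpace ℝ W]
    {i : H →L[ℝ] W} (R : WienerRotation i) (T : W → W) : Prop :=
  ∀ (φ : StrongDual ℝ W) (w : W), φ (T w) = R.dualHomeo.symm φ w

/-- The translation `T_h w = w + h` of `W` by the element `h` of `H`. -/
def wienerTranslation {H W : Type*}
    [NormedAddCommGroup H] [InnerProductSpace ℝ H]
    [NormedAddCommGroup W] [NormedSpace ℝ W]
    (i : H →L[ℝ] W) (h : H) (w : W) : W :=
  w + i h

/-- The Radon-Nikodym derivative `J_h = d(T_h)_* μ / dμ`, with values in `[0, ∞]`. -/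
noncomputable def wienerJ {H W : Type*}
    [NormedAddCommGroup H] [InnerProductSpace ℝ H]
    [NormedAddCommGroup W] [NormedSpace ℝ W] [MeasurableSpace W]
    (i : H →L[ℝ] W) (μ : Measure W) (h : H) : W → ENNReal :=
  (μ.map (wienerTranslation i h)).rnDeriv μ

/-! Finite Borel measures on `W` are determined by their characteristic functionals, so both parts
reduce to computing one. Translations: on the dual, `φ ↦ φ` is an isometry from the norm of `H` to
`L²(μ)`. By density, each `h` yields a centred Gaussian variable `X` of variance `‖h‖²`, jointly
Gaussian with every `φ` (`exists_gaussian_extension`). The Cameron–Martin density of the translate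
is `exp (X - ‖h‖² / 2)`, which is positive, and its `L^p` norm is a Gaussian moment; hence equality
in the bound. Rotations: the adjoint is constructed in the bidual and shown to land in `W`. It
preserves `μ` because the characteristic functional of `μ` depends only on the norm in `H`. -/

section Auxiliary

variable {H W : Type*} [NormedAddCommGroup H] [InnerProductSpace ℝ H] [CompleteSpace H]
  [NormedAddCommGroup W] [NormedSpace ℝ W]

/-! ### The dual of `W` inside `H`. -/

theorem dualToH_sub (i : H →L[ℝ] W) (φ ψ : StrongDual ℝ W) :
    dualToH i (φ - ψ) = dualToH i φ - dualToH i ψ := by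
  simp [dualToH, ContinuousLinearMap.sub_comp]

theorem dualToH_add (i : H →L[ℝ] W) (φ ψ : StrongDual ℝ W) :
    dualToH i (φ + ψ) = dualToH i φ + dualToH i ψ := by
  simp [dualToH, ContinuousLinearMap.add_comp]

theorem dualToH_smul (i : H →L[ℝ] W) (c : ℝ) (φ : StrongDual ℝ W) :
    dualToH i (c • φ) = c • dualToH i φ := by
  simp [dualToH]

theorem norm_dualToH (i : H →L[ℝ] W) (φ : StrongDual ℝ W) :
    ‖dualToH i φ‖ = ‖φ.comp i‖ := by
  simp [dualToH]

theorem dualToH_injective {i : H →L[ℝ] W} (hi : DenseRange i) :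
    Function.Injective (dualToH i) := by
  intro φ ψ hφψ
  apply ContinuousLinearMap.coeFn_injective
  refine hi.equalizer φ.continuous ψ.continuous ?_
  ext x
  simp [← inner_dualToH, hφψ]

/-- A vector `x` orthogonal to the range has `φ (i x) = 0` for all `φ`, so `i x = 0` by Hahn–Banach.
-/
theorem denseRange_dualToH {i : H →L[ℝ] W} (hi : Function.Injective i) :
    DenseRange (dualToH i) := by
  let K : Submodule ℝ H :=
    { carrier := Set.range (dualToH i)
      add_mem' := by
        rintro _ _ ⟨φ, rfl⟩ ⟨ψ, rfl⟩
        exact ⟨φ + ψ, dualToH_add i φ ψ⟩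
      zero_mem' := ⟨0, by simp [dualToH]⟩
      smul_mem' := by
        rintro c _ ⟨φ, rfl⟩
        exact ⟨c • φ, dualToH_smul i c φ⟩ }
  have hK : K.topologicalClosure = ⊤ := by
    rw [Submodule.topologicalClosure_eq_top_iff, Submodule.eq_bot_iff]
    intro x hx
    apply hi
    rw [map_zero]
    refine SeparatingDual.eq_zero_of_forall_dual_eq_zero (R := ℝ) fun φ ↦ ?_
    rw [← inner_dualToH]
    exact (Submodule.mem_orthogonal K x).1 hx _ ⟨φ, rfl⟩
  exact Submodule.dense_iff_topologicalClosure_eq_top.2 hK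

/-! ### Gaussian variables and the Cameron–Martin formula. -/

namespace IsAbstractWienerSpace

variable [MeasurableSpace W] {i : H →L[ℝ] W} {μ : Measure W}

theorem charFunDual_eq (hμ : IsAbstractWienerSpace i μ) (φ : StrongDual ℝ W) :
    charFunDual μ φ = Complex.exp (-((‖dualToH i φ‖ : ℂ) ^ 2) / 2) := by
  rw [charFunDual_apply, hμ.charFunctional, norm_dualToH]

variable [BorelSpace W]

theorem map_dual (hμ : IsAbstractWienerSpace i μ) (φ : StrongDual ℝ W) :
    μ.map φ = gaussianReal 0 (‖dualToH i φ‖₊ ^ 2) := by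
  have := hμ.isProbabilityMeasure
  apply Measure.ext_of_charFun
  ext t
  rw [charFun_map_eq_charFunDual_smul, hμ.charFunDual_eq, dualToH_smul, charFun_gaussianReal,
    norm_smul]
  congr 1
  push_cast
  rw [mul_pow, ← Complex.ofReal_pow ‖t‖, Real.norm_eq_abs, sq_abs]
  push_cast
  ring

theorem memLp_dual (hμ : IsAbstractWienerSpace i μ) (φ : StrongDual ℝ W) :
    MemLp φ 2 μ := by
  have h : MemLp id 2 (μ.map φ) := by
    rw [hμ.map_dual]
    exact memLp_id_gaussianReal' 2 (by simp)
  exact (memLp_map_measure_iff (g := id) (f := φ) (by fun_prop) (by fun_prop)).1 h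

theorem norm_toLp_dual (hμ : IsAbstractWienerSpace i μ) (φ : StrongDual ℝ W) :
    ‖(hμ.memLp_dual φ).toLp φ‖ = ‖dualToH i φ‖ := by
  have := hμ.isProbabilityMeasure
  have h1 : ∫ x, (φ x) ^ 2 ∂μ = ‖dualToH i φ‖ ^ 2 := by
    have h2 : ∫ y, y ^ 2 ∂(μ.map φ) = ‖dualToH i φ‖ ^ 2 := by
      have h := variance_id_gaussianReal (μ := 0) (v := ‖dualToH i φ‖₊ ^ 2)
      rw [variance_eq_integral (by fun_prop)] at h
      simpa [integral_id_gaussianReal, hμ.map_dual] using h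
    rwa [integral_map (by fun_prop) (by fun_prop)] at h2
  rw [← sq_eq_sq₀ (norm_nonneg _) (norm_nonneg _), ← h1, ← real_inner_self_eq_norm_sq,
    L2.inner_def]
  apply integral_congr_ae
  filter_upwards [(hμ.memLp_dual φ).coeFn_toLp] with x hx
  simp [hx, sq]

/-- `X` is the Paley–Wiener integral of `h`: an `L²` limit of functionals whose representatives tend
to `h`. Along an almost everywhere convergent subsequence the characteristic functions converge by
domination. The joint law with `φ` is kept because independence is read off from it later. -/
theorem exists_gaussian_extension (hμ : IsAbstractWienerSpace i μ) (h : H) :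
    ∃ X : W → ℝ, Measurable X ∧ ∀ (φ : StrongDual ℝ W) (s t : ℝ),
      ∫ x, Complex.exp (((s * X x + t * φ x : ℝ) : ℂ) * Complex.I) ∂μ =
        Complex.exp (-((‖s • h + t • dualToH i φ‖ : ℂ) ^ 2) / 2) := by
  have := hμ.isProbabilityMeasure
  obtain ⟨u, hu, hlim⟩ := mem_closure_iff_seq_limit.1 (denseRange_dualToH hμ.injective h)
  choose ψ hψ using hu
  let v : ℕ → Lp ℝ 2 μ := fun n ↦ (hμ.memLp_dual (ψ n)).toLp (ψ n)
  have hdist : ∀ n m, dist (v n) (v m) = dist (u n) (u m) := by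
    intro n m
    rw [dist_eq_norm, dist_eq_norm, ← hψ, ← hψ, ← dualToH_sub, ← hμ.norm_toLp_dual]
    rfl
  have hv : CauchySeq v := by
    have := hlim.cauchySeq
    rw [Metric.cauchySeq_iff] at this ⊢
    simpa only [hdist] using this
  obtain ⟨X, hX⟩ := cauchySeq_tendsto_of_complete hv
  obtain ⟨ns, hns, hae⟩ := (tendstoInMeasure_of_tendsto_Lp hX).exists_seq_tendsto_ae
  refine ⟨X, (Lp.stronglyMeasurable X).measurable, fun φ s t ↦ ?_⟩
  have hL : Filter.Tendsto (fun n ↦ ∫ x, Complex.exp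
      (((s * ψ (ns n) x + t * φ x : ℝ) : ℂ) * Complex.I) ∂μ) Filter.atTop
      (nhds (∫ x, Complex.exp (((s * X x + t * φ x : ℝ) : ℂ) * Complex.I) ∂μ)) := by
    refine tendsto_integral_of_dominated_convergence (fun _ ↦ 1) (fun n ↦ ?_)
      (integrable_const _) (fun n ↦ ?_) ?_
    · exact (Measurable.aestronglyMeasurable (by fun_prop))
    · exact ae_of_all _ fun x ↦ (Complex.norm_exp_ofReal_mul_I _).le
    · have hall : ∀ᵐ x ∂μ, ∀ n, (v (ns n)) x = ψ (ns n) x :=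
        ae_all_iff.2 fun n ↦ (hμ.memLp_dual (ψ (ns n))).coeFn_toLp
      filter_upwards [hae, hall] with x hx hx'
      simp only [hx'] at hx
      have hc : Continuous fun y : ℝ ↦
          Complex.exp (((s * y + t * φ x : ℝ) : ℂ) * Complex.I) := by fun_prop
      exact (hc.tendsto _).comp hx
  refine tendsto_nhds_unique hL ?_
  have hc : Continuous fun y : H ↦
      Complex.exp (-((‖s • y + t • dualToH i φ‖ : ℂ) ^ 2) / 2) := by fun_prop
  refine ((hc.tendsto h).comp (hlim.comp hns.tendsto_atTop)).congr fun n ↦ ?_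
  have := hμ.charFunDual_eq (s • ψ (ns n) + t • φ)
  rw [charFunDual_apply, dualToH_add, dualToH_smul, dualToH_smul, hψ] at this
  simpa using this.symm

/-- The joint law of a functional `φ` and the Gaussian variable associated with `h`, integrated
against the exponential density. -/
theorem integral_exp_mul_density (hμ : IsAbstractWienerSpace i μ) {h : H} {X : W → ℝ}
    (hXm : Measurable X) (hX : ∀ (φ : StrongDual ℝ W) (s t : ℝ),
      ∫ x, Complex.exp (((s * X x + t * φ x : ℝ) : ℂ) * Complex.I) ∂μ =
        Complex.exp (-((‖s • h + t • dualToH i φ‖ : ℂ) ^ 2) / 2))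
    (hlaw : μ.map X = gaussianReal 0 (‖h‖₊ ^ 2)) (φ : StrongDual ℝ W) :
    ∫ x, Complex.exp (φ x * Complex.I) * Complex.exp (X x - (‖h‖ : ℂ) ^ 2 / 2) ∂μ =
      Complex.exp (-((‖dualToH i φ‖ : ℂ) ^ 2) / 2) * Complex.exp (φ (i h) * Complex.I) := by
  have := hμ.isProbabilityMeasure
  set k := dualToH i φ with hk
  -- Coefficient of the projection of `k` on `h`. For `h = 0` the division gives `c = 0`, and `hch`
  -- still holds.
  set c : ℝ := inner ℝ k h / ‖h‖ ^ 2 with hc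
  have hch : c * ‖h‖ ^ 2 = inner ℝ k h := by
    by_cases h0 : h = 0
    · simp [h0]
    · rw [hc]; field_simp
  -- The part of `φ` orthogonal to `X`: the cross term in `hXY` cancels, so `X` and `Y` are
  -- independent.
  set Y : W → ℝ := fun x ↦ φ x - c * X x with hY
  have hYm : Measurable Y := by fun_prop
  have hXY : ∀ s t : ℝ, ∫ x, Complex.exp (((s * X x + t * Y x : ℝ) : ℂ) * Complex.I) ∂μ =
      Complex.exp (-((s : ℂ) ^ 2 * (‖h‖ : ℂ) ^ 2) / 2)
        * Complex.exp (-((t : ℂ) ^ 2 * (‖k‖ ^ 2 - c ^ 2 * ‖h‖ ^ 2)) / 2) := by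
    intro s t
    have h1 := hX φ (s - t * c) t
    have h2 : ‖(s - t * c) • h + t • k‖ ^ 2
        = s ^ 2 * ‖h‖ ^ 2 + t ^ 2 * (‖k‖ ^ 2 - c ^ 2 * ‖h‖ ^ 2) := by
      rw [norm_add_sq_real, norm_smul, norm_smul, inner_smul_left, inner_smul_right,
        real_inner_comm, ← hch, mul_pow, mul_pow, Real.norm_eq_abs, Real.norm_eq_abs, sq_abs,
        sq_abs]
      simp
      ring
    rw [← Complex.ofReal_pow, h2] at h1
    rw [← Complex.exp_add]
    convert h1 using 2
    · ext x
      congr 3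
      simp only [hY]
      ring
    · push_cast
      ring
  have hXc : ∀ s : ℝ, charFun (μ.map X) s = Complex.exp (-((s : ℂ) ^ 2 * (‖h‖ : ℂ) ^ 2) / 2) := by
    intro s
    rw [charFun_apply_real, integral_map (by fun_prop) (by fun_prop)]
    simpa using hXY s 0
  have hYc : ∀ t : ℝ, charFun (μ.map Y) t =
      Complex.exp (-((t : ℂ) ^ 2 * (‖k‖ ^ 2 - c ^ 2 * ‖h‖ ^ 2)) / 2) := by
    intro t
    rw [charFun_apply_real, integral_map (by fun_prop) (by fun_prop)]
    simpa using hXY 0 t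
  have hind : IndepFun X Y μ := by
    rw [indepFun_iff_charFun_prod (by fun_prop) (by fun_prop)]
    intro t
    rw [hXc, hYc, ← hXY, charFun_apply, integral_map (by fun_prop) (by fun_prop)]
    simp [WithLp.prod_inner_apply, mul_comm]
  -- Since `φ = Y + c X`, the integrand is, up to a constant, the product of these two independent
  -- factors.
  have hind' : IndepFun (fun x ↦ Complex.exp ((1 + c * Complex.I) * X x))
      (fun x ↦ Complex.exp (Y x * Complex.I)) μ :=
    hind.comp (φ := fun r : ℝ ↦ Complex.exp ((1 + c * Complex.I) * r))
      (ψ := fun r : ℝ ↦ Complex.exp (r * Complex.I)) (by fun_prop) (by fun_prop)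
  have hprod := hind'.integral_fun_mul_eq_mul_integral (by fun_prop) (by fun_prop)
  have hXi := complexMGF_gaussianReal hlaw (1 + c * Complex.I)
  rw [complexMGF] at hXi
  have hYi := hXY 0 1
  simp only [zero_mul, zero_add, one_mul] at hYi
  rw [hXi, hYi] at hprod
  rw [← inner_dualToH, ← hk, ← hch]
  calc _ = ∫ x, Complex.exp (-(‖h‖ : ℂ) ^ 2 / 2) *
        (Complex.exp ((1 + c * Complex.I) * X x) * Complex.exp (Y x * Complex.I)) ∂μ := by
        congr with x
        simp only [hY, ← Complex.exp_add]
        congr 1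
        push_cast
        ring
    _ = _ := by
        rw [integral_const_mul, hprod]
        simp only [← Complex.exp_add]
        congr 1
        push_cast
        linear_combination ((‖h‖ : ℂ) ^ 2 * (c : ℂ) ^ 2 / 2) * Complex.I_sq

/-- The Cameron–Martin formula. -/
theorem exists_map_translation_eq_withDensity [CompleteSpace W]
    [TopologicalSpace.SeparableSpace W] (hμ : IsAbstractWienerSpace i μ) (h : H) :
    ∃ X : W → ℝ, Measurable X ∧ μ.map X = gaussianReal 0 (‖h‖₊ ^ 2) ∧
      μ.map (wienerTranslation i h) =
        μ.withDensity fun x ↦ ENNReal.ofReal (Real.exp (X x - ‖h‖ ^ 2 / 2)) := by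
  have := hμ.isProbabilityMeasure
  have : SecondCountableTopology W := UniformSpace.secondCountable_of_separable W
  obtain ⟨X, hXm, hX⟩ := hμ.exists_gaussian_extension h
  have hlaw : μ.map X = gaussianReal 0 (‖h‖₊ ^ 2) := by
    apply Measure.ext_of_charFun
    ext s
    have h1 := hX 0 s 0
    rw [charFun_apply_real, integral_map (by fun_prop) (by fun_prop), charFun_gaussianReal]
    simp only [zero_smul, add_zero, zero_mul, norm_smul, Complex.ofReal_mul] at h1
    rw [h1.trans]
    congr 1
    push_cast
    rw [mul_pow, ← Complex.ofReal_pow ‖s‖, Real.norm_eq_abs, sq_abs]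
    push_cast
    ring
  refine ⟨X, hXm, hlaw, ?_⟩
  have hint : Integrable (fun x ↦ Real.exp (X x - ‖h‖ ^ 2 / 2)) μ := by
    have h1 : Integrable (fun y ↦ Real.exp (1 * y)) (μ.map X) := by
      rw [hlaw]
      exact integrable_exp_mul_gaussianReal 1
    have h2 := (integrable_map_measure (by fun_prop) (by fun_prop)).1 h1
    simpa [Function.comp_def, Real.exp_sub] using h2.div_const _
  have : IsFiniteMeasure (μ.withDensity fun x ↦ ENNReal.ofReal (Real.exp (X x - ‖h‖ ^ 2 / 2))) :=
    isFiniteMeasure_withDensity_ofReal hint.2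
  have hT : wienerTranslation i h = fun w ↦ w + i h := rfl
  have : IsFiniteMeasure (μ.map (wienerTranslation i h)) := by infer_instance
  -- Translation multiplies the characteristic functional by `exp (i φ(h))`, the factor produced by
  -- the density.
  apply Measure.ext_of_charFunDual
  ext φ
  rw [hT, charFunDual_map_add_const, hμ.charFunDual_eq,
    ← hμ.integral_exp_mul_density hXm hX hlaw φ, charFunDual_apply,
    integral_withDensity_eq_integral_toReal_smul (by fun_prop) (by simp)]
  congr with x
  rw [ENNReal.toReal_ofReal (Real.exp_pos _).le, Complex.real_smul, mul_comm]
  push_cast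
  rfl

end IsAbstractWienerSpace

/-- The moment generating function at `p` is `exp (p² a² / 2)`; the normalisation subtracts `p a² /
2` from the exponent, and the `p`-th root divides it by `p`. -/
theorem eLpNorm_exp_gaussian {Ω : Type*} [MeasurableSpace Ω] {μ : Measure Ω}
    {X : Ω → ℝ} {a : NNReal} (hXm : Measurable X)
    (hlaw : μ.map X = gaussianReal 0 (a ^ 2)) {p : ℝ} (hp : 1 ≤ p) :
    eLpNorm (fun x ↦ ENNReal.ofReal (Real.exp (X x - (a : ℝ) ^ 2 / 2))) (ENNReal.ofReal p) μ =
      ENNReal.ofReal (Real.exp ((p - 1) * (a : ℝ) ^ 2 / 2)) := by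
  have hp0 : 0 < p := by linarith
  have hint : Integrable (fun x ↦ Real.exp (p * X x)) μ := by
    have h1 : Integrable (fun y ↦ Real.exp (p * y)) (μ.map X) := by
      rw [hlaw]
      exact integrable_exp_mul_gaussianReal p
    exact (integrable_map_measure (f := X) (g := fun y ↦ Real.exp (p * y)) (by fun_prop)
      (by fun_prop)).1 h1
  have hmgf := mgf_gaussianReal hlaw p
  rw [mgf] at hmgf
  rw [eLpNorm_eq_lintegral_rpow_enorm_toReal (by simpa using hp0) (by simp),
    ENNReal.toReal_ofReal hp0.le]
  have h1 : ∫⁻ x, ‖ENNReal.ofReal (Real.exp (X x - (a : ℝ) ^ 2 / 2))‖ₑ ^ p ∂μ =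
      ENNReal.ofReal (Real.exp (p * ((p - 1) * (a : ℝ) ^ 2 / 2))) := by
    calc _ = ∫⁻ x, ENNReal.ofReal (Real.exp (-(p * (a : ℝ) ^ 2 / 2)) * Real.exp (p * X x)) ∂μ := by
          congr with x
          rw [enorm_eq_self, ENNReal.ofReal_rpow_of_pos (Real.exp_pos _), ← Real.exp_mul,
            ← Real.exp_add]
          congr 2
          ring
      _ = _ := by
          rw [← ofReal_integral_eq_lintegral_ofReal (hint.const_mul _)
            (ae_of_all _ fun x ↦ by positivity), integral_const_mul, hmgf, ← Real.exp_add]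
          congr 2
          rw [NNReal.coe_pow]
          ring
  rw [h1, ENNReal.ofReal_rpow_of_pos (Real.exp_pos _), ← Real.exp_mul]
  congr 2
  field_simp

/-! ### Rotations and their adjoints. -/

namespace WienerRotation

/-- The inverse of a rotation on the dual space, as a continuous linear map. -/
noncomputable def dualInv {i : H →L[ℝ] W} (hi : DenseRange i) (R : WienerRotation i) :
    StrongDual ℝ W →L[ℝ] StrongDual ℝ W where
  toFun := R.dualHomeo.symm
  -- `dualHomeo` is only assumed to be a homeomorphism; its linearity is inherited from `toH`
  -- through the injectivity of `dualToH`.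
  map_add' φ ψ := by
    have hadd : ∀ φ ψ, R.dualHomeo (φ + ψ) = R.dualHomeo φ + R.dualHomeo ψ := fun φ ψ ↦
      dualToH_injective hi (by simp only [dualToH_add, R.dualToH_dualHomeo, map_add])
    apply R.dualHomeo.injective
    simp [hadd]
  map_smul' c φ := by
    have hsmul : ∀ φ, R.dualHomeo (c • φ) = c • R.dualHomeo φ := fun φ ↦
      dualToH_injective hi (by simp only [dualToH_smul, R.dualToH_dualHomeo, map_smul])
    apply R.dualHomeo.injective
    simp [hsmul]
  cont := R.dualHomeo.symm.continuous

theorem dualToH_dualHomeo_symm {i : H →L[ℝ] W} (R : WienerRotation i) (φ : StrongDual ℝ W) :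
    dualToH i (R.dualHomeo.symm φ) = R.toH.symm (dualToH i φ) := by
  rw [LinearIsometryEquiv.eq_symm_apply, ← R.dualToH_dualHomeo, Homeomorph.apply_symm_apply]

/-- `S` is `w` followed by the bidual transpose of `R⁻¹`. On `i x` it is evaluation at `i (R x)`, by
orthogonality of `R`. As `W` is complete, its image in the bidual is closed, so density of `H` puts
all values of `S` in that image. -/
theorem exists_isAdjoint [CompleteSpace W] {i : H →L[ℝ] W} (hi : DenseRange i)
    (R : WienerRotation i) : ∃ T : W → W, R.IsAdjoint T := by
  let J := NormedSpace.inclusionInDoubleDualLi ℝ (E := W)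
  let S : W → StrongDual ℝ (StrongDual ℝ W) := fun w ↦ (J w).comp (R.dualInv hi)
  have hS : Continuous S := by
    exact ((ContinuousLinearMap.precomp ℝ (R.dualInv hi)).continuous).comp J.continuous
  have hmem : ∀ w, S w ∈ Set.range J := by
    intro w
    have hcl : IsClosed (Set.range J) := 
      J.isometry.isUniformInducing.isComplete_range.isClosed
    refine hi.induction_on (p := fun w ↦ S w ∈ Set.range J) w (hcl.preimage hS) fun x ↦ ?_
    refine ⟨i (R.toH x), ?_⟩
    ext φ
    change φ (i (R.toH x)) = R.dualHomeo.symm φ (i x)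
    rw [← inner_dualToH, ← inner_dualToH, dualToH_dualHomeo_symm,
      ← R.toH.inner_map_map (R.toH.symm _), LinearIsometryEquiv.apply_symm_apply]
  choose T hT using hmem
  refine ⟨T, fun φ w ↦ ?_⟩
  exact congrArg (fun f : StrongDual ℝ (StrongDual ℝ W) ↦ f φ) (hT w)

theorem IsAdjoint.eq {i : H →L[ℝ] W} {R : WienerRotation i} {T T' : W → W}
    (hT : R.IsAdjoint T) (hT' : R.IsAdjoint T') : T = T' := by
  ext w
  rw [SeparatingDual.eq_iff_forall_dual_eq (R := ℝ)]
  intro φ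
  rw [hT, hT']

/-- The adjoint of a rotation, as a continuous linear map. -/
theorem IsAdjoint.exists_continuousLinearMap {i : H →L[ℝ] W} (hi : DenseRange i)
    {R : WienerRotation i} {T : W → W} (hT : R.IsAdjoint T) : ∃ L : W →L[ℝ] W, ⇑L = T := by
  let L : W →ₗ[ℝ] W :=
    { toFun := T
      map_add' := fun x y ↦ by
        rw [SeparatingDual.eq_iff_forall_dual_eq (R := ℝ)]
        intro φ
        simp [hT _ _]
      map_smul' := fun c x ↦ by
        rw [SeparatingDual.eq_iff_forall_dual_eq (R := ℝ)]
        intro φ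
        simp [hT _ _] }
  refine ⟨L.mkContinuous ‖R.dualInv hi‖ fun w ↦ ?_, rfl⟩
  refine NormedSpace.norm_le_dual_bound ℝ _ (by positivity) fun φ ↦ ?_
  change ‖φ (T w)‖ ≤ _
  rw [hT]
  calc ‖R.dualInv hi φ w‖ ≤ ‖R.dualInv hi φ‖ * ‖w‖ := ContinuousLinearMap.le_opNorm _ _
    _ ≤ ‖R.dualInv hi‖ * ‖φ‖ * ‖w‖ := by gcongr; exact ContinuousLinearMap.le_opNorm _ _
    _ = _ := by ring

theorem IsAdjoint.measurePreserving [CompleteSpace W] [TopologicalSpace.SeparableSpace W]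
    [MeasurableSpace W] [BorelSpace W] {i : H →L[ℝ] W} {μ : Measure W}
    (hμ : IsAbstractWienerSpace i μ) {R : WienerRotation i} {T : W → W} (hT : R.IsAdjoint T) :
    MeasurePreserving T μ μ := by
  have := hμ.isProbabilityMeasure
  have : SecondCountableTopology W := UniformSpace.secondCountable_of_separable W
  obtain ⟨L, rfl⟩ := hT.exists_continuousLinearMap hμ.denseRange
  refine ⟨by fun_prop, ?_⟩
  apply Measure.ext_of_charFunDual
  ext φ
  have hφ : φ.comp L = R.dualHomeo.symm φ := by
    ext w
    exact hT φ w
  rw [charFunDual_map, hφ, hμ.charFunDual_eq, hμ.charFunDual_eq, dualToH_dualHomeo_symm,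
    LinearIsometryEquiv.norm_map]

end WienerRotation

end Auxiliary

/-- The Gaussian measure of an abstract Wiener space is quasi-invariant under translations by
elements of `H`, the Radon-Nikodym derivatives satisfy the stated `L^p` bound, which is sharp
(it holds with equality for every `h` and `p`), and the measure is invariant under rotations. -/
theorem proposition5p5 {H W : Type*}
    [NormedAddCommGroup H] [InnerProductSpace ℝ H] [CompleteSpace H]
    [TopologicalSpace.SeparableSpace H]
    [NormedAddCommGroup W] [NormedSpace ℝ W] [CompleteSpace W]
    [TopologicalSpace.SeparableSpace W] [MeasurableSpace W] [BorelSpace W]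
    (i : H →L[ℝ] W) (μ : Measure W) (hμ : IsAbstractWienerSpace i μ) :
    (∀ h : H,
      μ.map (wienerTranslation i h) ≪ μ ∧ μ ≪ μ.map (wienerTranslation i h)) ∧
    (∀ (h : H) (p : ℝ), 1 ≤ p →
      eLpNorm (wienerJ i μ h) (ENNReal.ofReal p) μ ≤
        ENNReal.ofReal (Real.exp ((p - 1) * ‖h‖ ^ 2 / 2)) ∧
      eLpNorm (wienerJ i μ h) (ENNReal.ofReal p) μ =
        ENNReal.ofReal (Real.exp ((p - 1) * ‖h‖ ^ 2 / 2))) ∧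
    (∀ R : WienerRotation i,
      (∃! T : W → W, R.IsAdjoint T) ∧
      ∀ T : W → W, R.IsAdjoint T → MeasurePreserving T μ μ) := by
  have := hμ.isProbabilityMeasure
  refine ⟨fun h ↦ ?_, fun h p hp ↦ ?_, fun R ↦ ⟨?_, fun T hT ↦ hT.measurePreserving hμ⟩⟩
  · obtain ⟨X, hXm, -, hX⟩ := hμ.exists_map_translation_eq_withDensity h
    rw [hX]
    refine ⟨withDensity_absolutelyContinuous _ _,
      withDensity_absolutelyContinuous' (by fun_prop) (ae_of_all _ fun x ↦ ?_)⟩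
    simpa using Real.exp_pos _
  · obtain ⟨X, hXm, hlaw, hX⟩ := hμ.exists_map_translation_eq_withDensity h
    have hJ : wienerJ i μ h =ᵐ[μ] fun x ↦ ENNReal.ofReal (Real.exp (X x - ‖h‖ ^ 2 / 2)) := by
      rw [wienerJ, hX]
      exact Measure.rnDeriv_withDensity μ (by fun_prop)
    have heq : eLpNorm (wienerJ i μ h) (ENNReal.ofReal p) μ =
        ENNReal.ofReal (Real.exp ((p - 1) * ‖h‖ ^ 2 / 2)) := by
      rw [eLpNorm_congr_ae hJ]
      exact eLpNorm_exp_gaussian (a := ‖h‖₊) hXm hlaw hp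
    exact ⟨heq.le, heq⟩
  · obtain ⟨T, hT⟩ := R.exists_isAdjoint hμ.denseRange
    exact ⟨T, hT, fun T' hT' ↦ hT'.eq hT⟩
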